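/- Let $N\in\mathbb{N}$ and $1<p<N$ ($p$ real). Let $V:(0,\infty)\to[0,\infty]$ be measurable with $V\in L^1((r_1,r_2))$ for some $0<r_1<r_2$, and let $K:(0,\infty)\to(0,\infty)$ be measurable with $K\in L^s_{\mathrm{loc}}((0,\infty))$ for some $s>1$. Let $D^{1,p}(\mathbb{R}^N)=\{u\in L^{p^*}(\mathbb{R}^N):\nabla u\in L^p(\mathbb{R}^N)\}$ with $p^*=pN/(N-p)$ and $\nabla u$ the weak gradient, let $$W=\Big\{u\in D^{1,p}(\mathbb{R}^N):\int_{\mathbb{R}^N}V(|x|)|u|^p\,dx<\infty\Big\},\qquad \|u\|=\Big(\int_{\mathbb{R}^N}\big(|\nabla u|^p+V(|x|)|u|^p\big)\,dx\Big)^{1/p},$$ and let $W_r$ be the subspace of radial functions in $W$. For $q>1$ and $R>0$ put $$\mathcal{R}_\infty(q,R)=\sup_{u\in W_r,\ h\in W,\ \|u\|=\|h\|=1}\ \int_{\{|x|\ge R\}}K(|x|)\,|u|^{q-1}|h|\,dx\in[0,\infty],$$ and for $\alpha\in\mathbb{R}$, $\beta\in[0,1]$ put $q^*(\alpha,\beta)=p\,\dfrac{\alpha-p\beta+N}{N-p}$.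 Suppose that there is $R_2>0$ such that $V(r)<\infty$ for almost every $r>R_2$ and, for some $0\le\beta_\infty\le1$ and $\alpha_\infty\in\mathbb{R}$, $$\operatorname*{ess\,sup}_{r>R_2}\frac{K(r)}{r^{\alpha_\infty}V(r)^{\beta_\infty}}<\infty,$$ where $V(r)^0=1$ for every $r$, and the quotient is $+\infty$ where its denominator vanishes. Then $$\lim_{R\to+\infty}\mathcal{R}_\infty(q_2,R)=0\qquad\text{for every real } q_2>\max\{1,\ p\beta_\infty,\ q^*(\alpha_\infty,\beta_\infty)\}.$$ -/

import Mathlib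

open MeasureTheory Set Filter Topology
open scoped ENNReal ContDiff

noncomputable section

namespace PLaplace

/-- `ℝ^N` with the Euclidean norm. -/
abbrev E (N : ℕ) : Type := EuclideanSpace ℝ (Fin N)

/-- `g` is a weak (distributional) gradient of `u` on `ℝ^N`. -/
def IsWeakGradient {N : ℕ} (u : E N → ℝ) (g : E N → E N) : Prop :=
  LocallyIntegrable u volume ∧ LocallyIntegrable g volume ∧
    ∀ φ : E N → ℝ, ContDiff ℝ ∞ φ → HasCompactSupport φ → ∀ i : Fin N,
      ∫ x, u x * fderiv ℝ φ x (EuclideanSpace.single i 1) = -∫ x, φ x * g x i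

/-- `u` has a locally integrable weak gradient. -/
def HasWeakGradient {N : ℕ} (u : E N → ℝ) : Prop :=
  ∃ g : E N → E N, IsWeakGradient u g

/-- Weak gradients are unique up to null sets. -/
theorem IsWeakGradient.ae_eq {N : ℕ} {u : E N → ℝ} {g g' : E N → E N}
    (h : IsWeakGradient u g) (h' : IsWeakGradient u g') : g =ᵐ[volume] g' := by
  have key : ∀ i : Fin N, ∀ᵐ x ∂(volume : Measure (E N)), g x i = g' x i := by
    intro i
    have hl : ∀ f : E N → E N, LocallyIntegrable f volume →
        LocallyIntegrable (fun x => f x i) volume := by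
      intro f hf x
      obtain ⟨s, hs, hfs⟩ := hf x
      exact ⟨s, hs, (EuclideanSpace.proj (𝕜 := ℝ) i).integrable_comp hfs⟩
    refine ae_eq_of_integral_contDiff_smul_eq (hl g h.2.1) (hl g' h'.2.1) ?_
    intro φ hφ hc
    have e := (h.2.2 φ hφ hc i).symm.trans (h'.2.2 φ hφ hc i)
    simpa using neg_injective e
  filter_upwards [ae_all_iff.2 key] with x hx
  ext i
  exact hx i

open Classical in
/-- The weak gradient `∇u`, well defined up to null sets (and `0` if there is none). -/
def weakGradient {N : ℕ} (u : E N → ℝ) : E N → E N :=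
  if h : HasWeakGradient u then h.choose else 0

/-- `u ∈ D^{1,p}(ℝ^N)`: `u ∈ L^{p*}` with `p* = pN/(N-p)`, and `∇u ∈ L^p`. -/
def MemD {N : ℕ} (p : ℝ) (u : E N → ℝ) : Prop :=
  MemLp u (ENNReal.ofReal (p * N / (N - p))) volume ∧
    HasWeakGradient u ∧ MemLp (weakGradient u) (ENNReal.ofReal p) volume

/-- `u` is (almost everywhere equal to) a radial function. -/
def IsRadial {N : ℕ} (u : E N → ℝ) : Prop :=
  ∃ f : ℝ → ℝ, ∀ᵐ x ∂(volume : Measure (E N)), u x = f ‖x‖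

/-- `u ∈ W = D^{1,p}(ℝ^N) ∩ L^p(ℝ^N, V(|x|) dx)`. -/
def MemW {N : ℕ} (p : ℝ) (V : ℝ → ℝ≥0∞) (u : E N → ℝ) : Prop :=
  MemD p u ∧ ∫⁻ x, V ‖x‖ * ‖u x‖ₑ ^ p < ⊤

/-- `u ∈ W_r`, the radial subspace of `W`. -/
def MemWr {N : ℕ} (p : ℝ) (V : ℝ → ℝ≥0∞) (u : E N → ℝ) : Prop :=
  MemW p V u ∧ IsRadial u

/-- The norm of `W`: `‖u‖ = (∫ |∇u|^p + V(|x|) |u|^p dx)^(1/p)`. -/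
def normW {N : ℕ} (p : ℝ) (V : ℝ → ℝ≥0∞) (u : E N → ℝ) : ℝ≥0∞ :=
  (∫⁻ x, (‖weakGradient u x‖ₑ ^ p + V ‖x‖ * ‖u x‖ₑ ^ p)) ^ (1 / p)

/-- `R_∞(q, R)`: the supremum, in `[0, ∞]`, of `∫_{|x| ≥ R} K(|x|) |u|^{q-1} |h| dx` over
`u ∈ W_r` and `h ∈ W` of norm one. -/
def RInfty (N : ℕ) (p : ℝ) (V : ℝ → ℝ≥0∞) (K : ℝ → ℝ) (q R : ℝ) : ℝ≥0∞ :=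
  ⨆ (u : E N → ℝ) (h : E N → ℝ) (_ : MemWr p V u) (_ : MemW p V h)
    (_ : normW p V u = 1) (_ : normW p V h = 1),
    ∫⁻ x in (Metric.ball (0 : E N) R)ᶜ,
      ENNReal.ofReal (K ‖x‖) * ‖u x‖ₑ ^ (q - 1) * ‖h x‖ₑ

/-- Condition (V): `V : (0,∞) → [0,∞]` is (Lebesgue) measurable and integrable on some interval
`(r₁, r₂)` with `0 < r₁ < r₂`. Values of `V` outside `(0,∞)` play no role. -/
def CondV (V : ℝ → ℝ≥0∞) : Prop :=
  AEMeasurable V (volume.restrict (Ioi 0)) ∧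
    ∃ r₁ r₂ : ℝ, 0 < r₁ ∧ r₁ < r₂ ∧ ∫⁻ r in Ioo r₁ r₂, V r < ⊤

/-- Condition (K): `K : (0,∞) → (0,∞)` is (Lebesgue) measurable and belongs to `L^s_loc((0,∞))`
for some `s > 1`. Values of `K` outside `(0,∞)` play no role. -/
def CondK (K : ℝ → ℝ) : Prop :=
  AEMeasurable K (volume.restrict (Ioi 0)) ∧ (∀ r, 0 < r → 0 < K r) ∧
    ∃ s : ℝ, 1 < s ∧ ∀ C : Set ℝ, IsCompact C → C ⊆ Ioi 0 →
      MemLp K (ENNReal.ofReal s) (volume.restrict C)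

/-- `q*(α, β) = p (α - p β + N) / (N - p)`. -/
def qStar (N : ℕ) (p α β : ℝ) : ℝ := p * ((α - p * β + N) / (N - p))

end PLaplace

end

noncomputable section

namespace PLaplace

variable {N : ℕ}

/-! For `|x| ≥ R > R₂` the hypothesis gives `K ≤ Λ |x|^α V^β`. Write `pβ = a + b` with `a = min 1
(pβ)` and regroup the integrand as `(V|h|^p)^(a/p) · (|h|^{p*})^((1-a)/p*) · (V|u|^p)^(b/p)` times a
power of `|x|` and the leftover `|u|^(q-1-b)`. The leftover is controlled by the decay `|u(x)| ≤ C
|x|^(-(N-p)/p)` of radial functions, so apart from the three displayed factors only a power of `|x|`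
remains. Hölder's inequality with a fourth exponent `θ = 1 - a/p - (1-a)/p* - b/p` then applies: the
`V`-factors are bounded by the norm, the `p*`-factor by Sobolev. The power of `|x|` has exponent `γ`
with `γ + Nθ = -((N-p)/p)(q - q*) < 0`; half of this gap makes the fourth integral converge at
infinity, the other half yields a factor `R^(-δ)`.

Both analytic inputs, `exists_sobolev_const` and `exists_radial_const`, are proved for compactly
supported `C¹` functions and transferred to `D^{1,p}` by `MemD.exists_approx`: mollify with a radial
kernel, which preserves radial symmetry and does not increase norms, then cut off. The quantitative
conclusion is `exists_RInfty_le`. -/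

/-- The norm pulls null sets of `(0,∞)` back to null sets. -/
theorem quasiMeasurePreserving_norm {N : ℕ} (hN : 1 ≤ N) :
    Measure.QuasiMeasurePreserving (fun x : E N => ‖x‖) volume (volume.restrict (Ioi 0)) := by
  refine ⟨measurable_norm, ?_⟩
  refine Measure.AbsolutelyContinuous.mk fun s hs h0 => ?_
  have : Nonempty (Fin N) := ⟨⟨0, hN⟩⟩
  have : Nontrivial (E N) := inferInstance
  rw [Measure.map_apply measurable_norm hs]
  set f : ℝ → ℝ := s.indicator 1 with hf
  have hz : (fun y : ℝ => y ^ (Module.finrank ℝ (E N) - 1) • f y) =ᵐ[volume.restrict (Ioi 0)] 0 := by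
    have : ∀ᵐ y ∂(volume.restrict (Ioi (0:ℝ))), y ∉ s := measure_eq_zero_iff_ae_notMem.1 h0
    filter_upwards [this] with y hy
    simp [hf, hy]
  -- Integrability is needed separately: a zero Bochner integral alone would not make the indicator
  -- vanish almost everywhere.
  have hi : Integrable (fun x : E N => f ‖x‖) volume := by
    rw [integrable_fun_norm_addHaar]
    exact (integrable_zero _ _ _).congr hz.symm
  have h1 : ∫ x : E N, f ‖x‖ = 0 := by
    rw [integral_fun_norm_addHaar, integral_congr_ae hz]
    simp
  have h2 := (integral_eq_zero_iff_of_nonneg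
    (fun x => indicator_nonneg (fun _ _ => zero_le_one) _) hi).1 h1
  rw [measure_eq_zero_iff_ae_notMem]
  filter_upwards [h2] with x hx hxs
  have hxs' : ‖x‖ ∈ s := hxs
  simp [hxs'] at hx

/-! ### Regularisation by radial mollifiers -/

/-- Jensen's inequality for convolution with a probability density. -/
theorem lintegral_rpow_lintegral_mul_le {N : ℕ} {p : ℝ} (hp : 1 ≤ p) {k f : E N → ℝ≥0∞}
    (hk : Measurable k) (hk1 : ∫⁻ x, k x = 1) (hf : AEMeasurable f volume) :
    ∫⁻ x, (∫⁻ y, k (x - y) * f y) ^ p ≤ ∫⁻ x, f x ^ p := by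
  have hp0 : 0 < p := by linarith
  have hk2 : ∀ x, ∫⁻ y, k (x - y) = 1 := fun x => by rw [lintegral_sub_left_eq_self k x, hk1]
  have hk3 : ∀ y, ∫⁻ x, k (x - y) = 1 := fun y => by rw [lintegral_sub_right_eq_self k y, hk1]
  have h1 : ∀ x, (∫⁻ y, k (x - y) * f y) ^ p ≤ ∫⁻ y, k (x - y) * f y ^ p := by
    intro x
    have hkx : Measurable fun y => k (x - y) := hk.comp (measurable_const.sub measurable_id)
    -- Hölder for `k f = (k f^p)^(1/p) · k^(1-1/p)`; the second factor integrates to `1`.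
    have h := ENNReal.lintegral_mul_norm_pow_le (μ := (volume : Measure (E N)))
      (f := fun y => k (x - y) * f y ^ p) (g := fun y => k (x - y))
      (hkx.aemeasurable.mul (hf.pow_const p)) hkx.aemeasurable (p := 1 / p) (q := 1 - 1 / p)
      (by positivity) (by rw [sub_nonneg, div_le_one hp0]; exact hp) (by ring)
    have h' : ∀ y, (k (x - y) * f y ^ p) ^ (1 / p) * k (x - y) ^ (1 - 1 / p) = k (x - y) * f y := by
      intro y
      rw [ENNReal.mul_rpow_of_nonneg _ _ (by positivity), ← ENNReal.rpow_mul,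
        mul_one_div_cancel hp0.ne', ENNReal.rpow_one, mul_right_comm,
        ← ENNReal.rpow_add_of_nonneg _ _ (by positivity)
          (by rw [sub_nonneg, div_le_one hp0]; exact hp)]
      simp
    simp_rw [h', hk2, ENNReal.one_rpow, mul_one] at h
    calc _ ≤ ((∫⁻ y, k (x - y) * f y ^ p) ^ (1 / p)) ^ p := by gcongr
      _ = _ := by rw [← ENNReal.rpow_mul, one_div_mul_cancel hp0.ne', ENNReal.rpow_one]
  calc _ ≤ ∫⁻ x, ∫⁻ y, k (x - y) * f y ^ p := lintegral_mono h1
    _ = ∫⁻ y, ∫⁻ x, k (x - y) * f y ^ p := by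
      refine lintegral_lintegral_swap ?_
      refine (hk.comp (measurable_fst.sub measurable_snd)).aemeasurable.mul ?_
      exact (hf.pow_const p).comp_quasiMeasurePreserving Measure.quasiMeasurePreserving_snd
    _ = ∫⁻ y, f y ^ p := by
      refine lintegral_congr fun y => ?_
      rw [lintegral_mul_const _ (by fun_prop), hk3, one_mul]

/-- A smooth radial bump supported in the unit ball. -/
def bump (N : ℕ) (x : E N) : ℝ := Real.smoothTransition (1 - ‖x‖ ^ 2)

theorem bump_contDiff (N : ℕ) : ContDiff ℝ ∞ (bump N) :=
  Real.smoothTransition.contDiff.comp (contDiff_const.sub (contDiff_norm_sq ℝ))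

theorem bump_nonneg {N : ℕ} (x : E N) : 0 ≤ bump N x := Real.smoothTransition.nonneg _

theorem bump_le_one {N : ℕ} (x : E N) : bump N x ≤ 1 := Real.smoothTransition.le_one _

theorem bump_eq_zero {N : ℕ} {x : E N} (hx : 1 ≤ ‖x‖) : bump N x = 0 :=
  Real.smoothTransition.zero_of_nonpos (by nlinarith)

theorem bump_hasCompactSupport (N : ℕ) : HasCompactSupport (bump N) :=
  HasCompactSupport.intro (isCompact_closedBall 0 1) fun x hx => bump_eq_zero <| by
    simp at hx; exact hx.le

theorem integral_bump_pos (N : ℕ) : 0 < ∫ x, bump N x :=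
  (bump_contDiff N).continuous.integral_pos_of_hasCompactSupport_nonneg_nonzero
    (bump_hasCompactSupport N) bump_nonneg (x := 0)
    (by simp [bump])

/-- A radial mollifier at scale `ε`. -/
def mollifier (N : ℕ) (ε : ℝ) (x : E N) : ℝ :=
  (ε ^ N * ∫ y, bump N y)⁻¹ * bump N (ε⁻¹ • x)

section mollifier

variable {ε : ℝ}

theorem mollifier_contDiff (N : ℕ) (ε : ℝ) : ContDiff ℝ ∞ (mollifier N ε) :=
  contDiff_const.mul ((bump_contDiff N).comp (contDiff_const_smul _))

theorem mollifier_nonneg (hε : 0 < ε) (x : E N) : 0 ≤ mollifier N ε x :=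
  mul_nonneg (inv_nonneg.2 (mul_nonneg (by positivity) (integral_bump_pos N).le)) (bump_nonneg _)

theorem mollifier_eq_zero (hε : 0 < ε) {x : E N} (hx : ε ≤ ‖x‖) : mollifier N ε x = 0 := by
  rw [mollifier, bump_eq_zero, mul_zero]
  rw [norm_smul, norm_inv, Real.norm_of_nonneg hε.le, inv_mul_eq_div, one_le_div hε]
  exact hx

theorem mollifier_congr {x y : E N} (h : ‖x‖ = ‖y‖) : mollifier N ε x = mollifier N ε y := by
  simp [mollifier, bump, norm_smul, h]

theorem mollifier_hasCompactSupport (hε : 0 < ε) : HasCompactSupport (mollifier N ε) :=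
  HasCompactSupport.intro (isCompact_closedBall 0 ε) fun x hx => mollifier_eq_zero hε <| by
    simp at hx; exact hx.le

theorem integral_mollifier (hε : 0 < ε) : ∫ x, mollifier N ε x = 1 := by
  simp only [mollifier]
  rw [integral_const_mul, Measure.integral_comp_inv_smul]
  have := (integral_bump_pos N).ne'
  simp only [finrank_euclideanSpace, Fintype.card_fin, smul_eq_mul, abs_of_pos (pow_pos hε N)]
  field_simp

theorem lintegral_mollifier (hε : 0 < ε) : ∫⁻ x, ENNReal.ofReal (mollifier N ε x) = 1 := by
  rw [← ofReal_integral_eq_lintegral_ofReal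
    ((mollifier_contDiff N ε).continuous.integrable_of_hasCompactSupport
      (mollifier_hasCompactSupport hε)) (Eventually.of_forall (mollifier_nonneg hε)),
    integral_mollifier hε, ENNReal.ofReal_one]

/-- The kernel bound required for convergence at Lebesgue points: height at most a constant over the
volume of a ball of radius `ε`. The centre `y` is arbitrary by translation invariance. -/
theorem mollifier_le (hε : 0 < ε) (x y : E N) :
    mollifier N ε x ≤ (volume.real (Metric.ball (0 : E N) 1) / ∫ y, bump N y) /
      volume.real (Metric.closedBall y ε) := by
  have h1 := integral_bump_pos N
  have hv : 0 < volume.real (Metric.ball (0 : E N) 1) :=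
    ENNReal.toReal_pos (Metric.measure_ball_pos _ _ one_pos).ne' measure_ball_lt_top.ne
  rw [Measure.addHaar_real_closedBall _ _ hε.le]
  simp only [finrank_euclideanSpace, Fintype.card_fin]
  have h3 : (ε ^ N * ∫ y, bump N y)⁻¹ * bump N (ε⁻¹ • x) ≤ (ε ^ N * ∫ y, bump N y)⁻¹ * 1 := by
    gcongr
    exact bump_le_one _
  refine h3.trans (le_of_eq ?_)
  field_simp

/-- The regularisation of `u` at scale `ε`. -/
def regularize (ε : ℝ) (u : E N → ℝ) (x : E N) : ℝ := ∫ y, mollifier N ε (x - y) * u y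

theorem regularize_eq_convolution (u : E N → ℝ) :
    regularize ε u = convolution (mollifier N ε) u (ContinuousLinearMap.lsmul ℝ ℝ) volume := by
  ext x
  rw [convolution_eq_swap]
  rfl

/-- Convergence holds at every Lebesgue point of `u` with respect to closed balls, because the
kernels have mass one, shrinking support and height comparable to the inverse volume of that
support. -/
theorem ae_tendsto_regularize {u : E N → ℝ} (hu : LocallyIntegrable u volume) {ε : ℕ → ℝ}
    (hε : ∀ n, 0 < ε n) (h0 : Tendsto ε atTop (𝓝 0)) :
    ∀ᵐ x, Tendsto (fun n => regularize (ε n) u x) atTop (𝓝 (u x)) := by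
  filter_upwards [(Besicovitch.vitaliFamily (volume : Measure (E N))).ae_tendsto_average_norm_sub
    hu] with x h
  have h0' : Tendsto ε atTop (𝓝[>] 0) := tendsto_nhdsWithin_iff.2 ⟨h0, Eventually.of_forall hε⟩
  have := (h.comp (Besicovitch.tendsto_filterAt volume x)).comp h0'
  apply tendsto_integral_smul_of_tendsto_average_norm_sub
    (volume.real (Metric.ball (0 : E N) 1) / ∫ y, bump N y) this
  · filter_upwards with i using hu.integrableOn_isCompact (isCompact_closedBall _ _)
  · apply tendsto_const_nhds.congr fun i => ?_
    rw [integral_sub_left_eq_self (mollifier N (ε i)), integral_mollifier (hε i)]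
  · filter_upwards with i y hy
    by_contra hy'
    rw [Metric.mem_closedBall, not_le, dist_eq_norm_sub'] at hy'
    exact hy (mollifier_eq_zero (hε i) hy'.le)
  · filter_upwards with i y
    rw [abs_of_nonneg (mollifier_nonneg (hε i) _)]
    exact mollifier_le (hε i) _ _

theorem regularize_contDiff (hε : 0 < ε) {u : E N → ℝ} (hu : LocallyIntegrable u volume) :
    ContDiff ℝ 1 (regularize ε u) := by
  rw [regularize_eq_convolution]
  exact (mollifier_hasCompactSupport hε).contDiff_convolution_left _
    ((mollifier_contDiff N ε).of_le (by simp)) hu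

theorem regularize_radial {u : E N → ℝ} (hu : IsRadial u) {x y : E N} (h : ‖x‖ = ‖y‖) :
    regularize ε u x = regularize ε u y := by
  obtain ⟨f, hf⟩ := hu
  -- The reflection exchanging `x` and `y` preserves Lebesgue measure, the kernel, and, almost
  -- everywhere, `u`.
  set T := Submodule.reflection (Submodule.span ℝ {x - y})ᗮ with hT
  have hTx : T x = y := Submodule.reflection_sub h
  have hf' : ∀ᵐ z, u (T z) = f ‖T z‖ :=
    T.measurePreserving.quasiMeasurePreserving.ae hf
  have hu' : ∀ᵐ z, u (T z) = u z := by
    filter_upwards [hf, hf'] with z h1 h2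
    rw [h2, h1, T.norm_map]
  rw [regularize, regularize,
    ← T.measurePreserving.integral_comp T.toHomeomorph.measurableEmbedding
      (fun z => mollifier N ε (y - z) * u z)]
  refine integral_congr_ae ?_
  filter_upwards [hu'] with z hz
  change _ = mollifier N ε (y - T z) * u (T z)
  rw [hz, ← hTx, ← map_sub, mollifier_congr (T.norm_map (x - z)).symm]

theorem enorm_regularize_le (hε : 0 < ε) (u : E N → ℝ) (x : E N) :
    ‖regularize ε u x‖ₑ ≤ ∫⁻ y, ENNReal.ofReal (mollifier N ε (x - y)) * ‖u y‖ₑ := by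
  refine (enorm_integral_le_lintegral_enorm _).trans (lintegral_mono fun y => ?_)
  rw [enorm_mul, Real.enorm_of_nonneg (mollifier_nonneg hε _)]

theorem integrable_fderiv_mollifier_smul (hε : 0 < ε) {u : E N → ℝ}
    (hu : LocallyIntegrable u volume) (x : E N) :
    Integrable fun y => u y • fderiv ℝ (mollifier N ε) (x - y) := by
  have hc : Continuous (fderiv ℝ (mollifier N ε)) :=
    (mollifier_contDiff N ε).continuous_fderiv (by simp)
  have hs := (mollifier_hasCompactSupport (N := N) hε).fderiv (𝕜 := ℝ)
  refine hu.integrable_smul_right_of_hasCompactSupport (hc.comp (continuous_const.sub continuous_id)) ?_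
  exact hs.comp_homeomorph (Homeomorph.subLeft x)

/-- The derivative falls on the kernel, and `y ↦ mollifier N ε (x - y)` is an admissible test
function. The sign from differentiating `x - y` in `y` cancels the sign in the definition of the
weak gradient. -/
theorem fderiv_regularize_apply (hε : 0 < ε) {u : E N → ℝ} {g : E N → E N}
    (hg : IsWeakGradient u g) (x : E N) (i : Fin N) :
    fderiv ℝ (regularize ε u) x (EuclideanSpace.single i 1) =
      ∫ y, mollifier N ε (x - y) * g y i := by
  have h1 := (mollifier_hasCompactSupport (N := N) hε).hasFDerivAt_convolution_left
    (ContinuousLinearMap.lsmul ℝ ℝ) ((mollifier_contDiff N ε).of_le (by simp)) hg.1 x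
  rw [← regularize_eq_convolution] at h1
  have hint := integrable_fderiv_mollifier_smul hε hg.1 x
  have h2 : convolution (fderiv ℝ (mollifier N ε)) u
      ((ContinuousLinearMap.lsmul ℝ ℝ).precompL (E N)) volume x =
      ∫ y, u y • fderiv ℝ (mollifier N ε) (x - y) := by
    rw [convolution_eq_swap]
    refine integral_congr_ae (Eventually.of_forall fun y => ?_)
    ext v
    simp [ContinuousLinearMap.precompL_apply, mul_comm]
  rw [h1.fderiv, h2, ContinuousLinearMap.integral_apply hint]
  have hφ : ContDiff ℝ ∞ fun y => mollifier N ε (x - y) :=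
    (mollifier_contDiff N ε).comp (contDiff_const.sub contDiff_id)
  have h3 := hg.2.2 (fun y => mollifier N ε (x - y)) hφ
    ((mollifier_hasCompactSupport hε).comp_homeomorph (Homeomorph.subLeft x)) i
  rw [← neg_eq_iff_eq_neg] at h3
  rw [← h3, ← integral_neg]
  refine integral_congr_ae (Eventually.of_forall fun y => ?_)
  have : fderiv ℝ (fun y => mollifier N ε (x - y)) y = - fderiv ℝ (mollifier N ε) (x - y) := by
    have := (((mollifier_contDiff N ε).differentiable (by simp) (x - y)).hasFDerivAt.comp y
      ((hasFDerivAt_const x y).sub (hasFDerivAt_id y))).fderiv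
    rw [show (fun y => mollifier N ε (x - y)) = mollifier N ε ∘ fun y => x - id y from rfl]
    refine Eq.trans this ?_
    ext; simp
  simp [this]

theorem enorm_fderiv_regularize_le (hε : 0 < ε) {u : E N → ℝ} {g : E N → E N}
    (hg : IsWeakGradient u g) (x : E N) :
    ‖fderiv ℝ (regularize ε u) x‖ₑ ≤ ∫⁻ y, ENNReal.ofReal (mollifier N ε (x - y)) * ‖g y‖ₑ := by
  have hint : Integrable fun y => mollifier N ε (x - y) • g y :=
    hg.2.1.integrable_smul_left_of_hasCompactSupport
      ((mollifier_contDiff N ε).continuous.comp (continuous_const.sub continuous_id))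
      ((mollifier_hasCompactSupport hε).comp_homeomorph (Homeomorph.subLeft x))
  -- Through the Riesz isometry the operator norm of the derivative becomes the Euclidean norm of
  -- the mollified gradient, so no dimensional constant is lost.
  have h : fderiv ℝ (regularize ε u) x =
      innerSL ℝ (∫ y, mollifier N ε (x - y) • g y) := by
    refine ContinuousLinearMap.coe_injective
      ((EuclideanSpace.basisFun (Fin N) ℝ).toBasis.ext fun i => ?_)
    simp only [OrthonormalBasis.coe_toBasis, EuclideanSpace.basisFun_apply,
      ContinuousLinearMap.coe_coe, innerSL_apply_apply, fderiv_regularize_apply hε hg x i]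
    rw [EuclideanSpace.inner_single_right]
    have := (EuclideanSpace.proj (𝕜 := ℝ) i).integral_comp_comm hint
    simpa using this
  rw [h, ← ofReal_norm, innerSL_apply_norm, ofReal_norm]
  refine (enorm_integral_le_lintegral_enorm _).trans (lintegral_mono fun y => ?_)
  rw [enorm_smul, Real.enorm_of_nonneg (mollifier_nonneg hε _)]

end mollifier

theorem eLpNorm_le_of_enorm_le_mollify {F G : Type*} [NormedAddCommGroup F]
    [NormedAddCommGroup G] {p ε : ℝ} (hp : 1 ≤ p) (hε : 0 < ε) {f : E N → F} {g : E N → G}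
    (hg : AEStronglyMeasurable g volume)
    (h : ∀ x, ‖f x‖ₑ ≤ ∫⁻ y, ENNReal.ofReal (mollifier N ε (x - y)) * ‖g y‖ₑ) :
    eLpNorm f (ENNReal.ofReal p) volume ≤ eLpNorm g (ENNReal.ofReal p) volume := by
  have hp0 : 0 < p := by linarith
  rw [eLpNorm_eq_lintegral_rpow_enorm_toReal (by simpa using hp0) ENNReal.ofReal_ne_top,
    eLpNorm_eq_lintegral_rpow_enorm_toReal (by simpa using hp0) ENNReal.ofReal_ne_top,
    ENNReal.toReal_ofReal hp0.le]
  refine ENNReal.rpow_le_rpow ?_ (by positivity)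
  refine le_trans (lintegral_mono fun x => ENNReal.rpow_le_rpow (h x) hp0.le) ?_
  exact lintegral_rpow_lintegral_mul_le hp
    (mollifier_contDiff N ε).continuous.measurable.ennreal_ofReal (lintegral_mollifier hε) hg.enorm

/-! ### Cutoffs and the error term in the product rule -/

/-- A smooth radial cutoff, equal to `1` on the ball of radius `m` and supported in the ball of
radius `2 m`. -/
def cutoff (N : ℕ) (m : ℝ) (x : E N) : ℝ := Real.smoothTransition (2 - ‖m⁻¹ • x‖ ^ 2)

theorem cutoff_contDiff (N : ℕ) (m : ℝ) : ContDiff ℝ ∞ (cutoff N m) :=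
  Real.smoothTransition.contDiff.comp
    (contDiff_const.sub ((contDiff_norm_sq ℝ).comp (contDiff_const_smul _)))

theorem cutoff_eq_one {m : ℝ} (hm : 0 < m) {x : E N} (hx : ‖x‖ ≤ m) : cutoff N m x = 1 := by
  refine Real.smoothTransition.one_of_one_le ?_
  have : ‖m⁻¹ • x‖ ≤ 1 := by
    rw [norm_smul, norm_inv, Real.norm_of_nonneg hm.le, inv_mul_eq_div, div_le_one hm]
    exact hx
  nlinarith [norm_nonneg (m⁻¹ • x)]

theorem cutoff_eq_zero {m : ℝ} (hm : 0 < m) {x : E N} (hx : 2 * m ≤ ‖x‖) : cutoff N m x = 0 := by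
  refine Real.smoothTransition.zero_of_nonpos ?_
  have : 2 ≤ ‖m⁻¹ • x‖ := by
    rw [norm_smul, norm_inv, Real.norm_of_nonneg hm.le, inv_mul_eq_div, le_div_iff₀ hm]
    exact hx
  nlinarith

theorem cutoff_congr (m : ℝ) {x y : E N} (h : ‖x‖ = ‖y‖) : cutoff N m x = cutoff N m y := by
  simp [cutoff, norm_smul, h]

theorem cutoff_hasCompactSupport {m : ℝ} (hm : 0 < m) : HasCompactSupport (cutoff N m) :=
  HasCompactSupport.intro (isCompact_closedBall 0 (2 * m)) fun x hx => cutoff_eq_zero hm <| by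
    simp at hx; exact hx.le

theorem fderiv_cutoff (m : ℝ) (x : E N) :
    fderiv ℝ (cutoff N m) x = m⁻¹ • fderiv ℝ (cutoff N 1) (m⁻¹ • x) := by
  have : cutoff N m = fun x => cutoff N 1 (m⁻¹ • x) := by
    ext x; simp [cutoff]
  rw [this, fderiv_comp_smul]

theorem exists_norm_fderiv_cutoff_le (N : ℕ) :
    ∃ M : ℝ, 0 ≤ M ∧ ∀ m : ℝ, 0 < m → ∀ x : E N, ‖fderiv ℝ (cutoff N m) x‖ ≤ M / m := by
  obtain ⟨M, hM⟩ := ((cutoff_contDiff N 1).continuous_fderiv (by simp)).bounded_above_of_compact_support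
    ((cutoff_hasCompactSupport (N := N) one_pos).fderiv (𝕜 := ℝ))
  refine ⟨M, (norm_nonneg _).trans (hM 0), fun m hm x => ?_⟩
  rw [fderiv_cutoff, norm_smul, norm_inv, Real.norm_of_nonneg hm.le, inv_mul_eq_div]
  gcongr
  exact hM _

theorem fderiv_cutoff_eq_zero {m : ℝ} (hm : 0 < m) {x : E N}
    (hx : x ∉ Metric.closedBall (0 : E N) (2 * m) \ Metric.ball 0 m) :
    fderiv ℝ (cutoff N m) x = 0 := by
  rcases lt_or_ge ‖x‖ m with h | h
  · have : cutoff N m =ᶠ[𝓝 x] fun _ => 1 := by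
      filter_upwards [(isOpen_lt continuous_norm continuous_const).mem_nhds h] with y hy
      exact cutoff_eq_one hm (le_of_lt hy)
    rw [this.fderiv_eq]; simp
  · have h2 : 2 * m < ‖x‖ := by
      by_contra hc
      exact hx ⟨by simpa using hc, by simpa using h⟩
    have : cutoff N m =ᶠ[𝓝 x] fun _ => 0 := by
      filter_upwards [(isOpen_lt continuous_const continuous_norm).mem_nhds h2] with y hy
      exact cutoff_eq_zero hm (le_of_lt hy)
    rw [this.fderiv_eq]; simp

theorem tendsto_eLpNorm_compl_ball {w : E N → ℝ} {r : ℝ} (hr : 0 < r)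
    (hw : MemLp w (ENNReal.ofReal r) volume) :
    Tendsto (fun m : ℕ => eLpNorm w (ENNReal.ofReal r)
      (volume.restrict (Metric.ball (0 : E N) (m + 1))ᶜ)) atTop (𝓝 0) := by
  have h1 : ∀ m : ℕ, eLpNorm w (ENNReal.ofReal r)
      (volume.restrict (Metric.ball (0 : E N) (m + 1))ᶜ) =
      ((volume.withDensity fun x => ‖w x‖ₑ ^ r) (Metric.ball (0 : E N) (m + 1))ᶜ) ^ (1 / r) := by
    intro m
    rw [eLpNorm_eq_lintegral_rpow_enorm_toReal (by simpa using hr) ENNReal.ofReal_ne_top,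
      withDensity_apply _ measurableSet_ball.compl, ENNReal.toReal_ofReal hr.le]
  have hfin : (volume.withDensity fun x => ‖w x‖ₑ ^ r) univ ≠ ⊤ := by
    rw [withDensity_apply _ MeasurableSet.univ, Measure.restrict_univ]
    have := lintegral_rpow_enorm_lt_top_of_eLpNorm_lt_top (by simpa using hr)
      ENNReal.ofReal_ne_top hw.2
    rw [ENNReal.toReal_ofReal hr.le] at this
    exact this.ne
  have h2 := tendsto_measure_iInter_atTop (μ := volume.withDensity fun x => ‖w x‖ₑ ^ r)
    (s := fun m : ℕ => (Metric.ball (0 : E N) (m + 1))ᶜ)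
    (fun m => measurableSet_ball.compl.nullMeasurableSet)
    (fun m n hmn => compl_subset_compl.2 (Metric.ball_subset_ball (by gcongr)))
    ⟨0, ne_top_of_le_ne_top hfin (measure_mono (subset_univ _))⟩
  have h3 : ⋂ m : ℕ, (Metric.ball (0 : E N) (m + 1))ᶜ = ∅ := by
    ext x
    simp only [mem_iInter, mem_compl_iff, mem_empty_iff_false, iff_false, not_forall, not_not]
    obtain ⟨n, hn⟩ := exists_nat_gt ‖x‖
    exact ⟨n, by simp; linarith⟩
  rw [h3, measure_empty] at h2
  simp_rw [h1]
  have h4 := h2.ennrpow_const (1 / r)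
  rwa [ENNReal.zero_rpow_of_pos (by positivity)] at h4

/-- The estimate is scale invariant. The gradient of the cutoff is `O(1/m)` on an annulus of radius
about `m`, and Hölder from `L^{p*}` to `L^p` there costs `|A|^(1/p - 1/p*) = |A|^(1/N) = O(m)`. What
survives is the tail of the `L^{p*}` norm of `w`. -/
theorem tendsto_eLpNorm_smul_fderiv_cutoff {p : ℝ} (hp : 1 < p) (hpN : p < N) {w : E N → ℝ}
    (hw : MemLp w (ENNReal.ofReal (p * N / (N - p))) volume) :
    Tendsto (fun m : ℕ => eLpNorm (fun x => w x • fderiv ℝ (cutoff N (m + 1)) x)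
      (ENNReal.ofReal p) volume) atTop (𝓝 0) := by
  obtain ⟨M, hM0, hM⟩ := exists_norm_fderiv_cutoff_le N
  have hN0 : (0 : ℝ) < N := by linarith
  have hNp : (0 : ℝ) < N - p := by linarith
  have hr : 0 < p * N / (N - p) := by positivity
  have hpr : p ≤ p * N / (N - p) := by
    rw [le_div_iff₀ hNp]; nlinarith
  have hexp : 1 / (ENNReal.ofReal p).toReal - 1 / (ENNReal.ofReal (p * N / (N - p))).toReal
      = 1 / N := by
    rw [ENNReal.toReal_ofReal (by linarith), ENNReal.toReal_ofReal hr.le]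
    field_simp
    ring
  set c : ℝ≥0∞ := ENNReal.ofReal (2 * M) * volume (Metric.ball (0 : E N) 1) ^ (1 / (N : ℝ)) with hc
  have hct : c ≠ ⊤ := ENNReal.mul_ne_top ENNReal.ofReal_ne_top
    (ENNReal.rpow_ne_top_of_nonneg (by positivity) measure_ball_lt_top.ne)
  have key : ∀ m : ℕ, eLpNorm (fun x => w x • fderiv ℝ (cutoff N (m + 1)) x)
      (ENNReal.ofReal p) volume ≤ c * eLpNorm w (ENNReal.ofReal (p * N / (N - p)))
        (volume.restrict (Metric.ball (0 : E N) (m + 1))ᶜ) := by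
    intro m
    have hm : (0 : ℝ) < m + 1 := by positivity
    set A : Set (E N) := Metric.closedBall (0 : E N) (2 * (m + 1)) \ Metric.ball 0 (m + 1) with hA
    have hAm : MeasurableSet A := measurableSet_closedBall.diff measurableSet_ball
    have e1 : eLpNorm (fun x => w x • fderiv ℝ (cutoff N (m + 1)) x) (ENNReal.ofReal p) volume ≤
        ENNReal.ofReal (M / (m + 1)) * eLpNorm (A.indicator w) (ENNReal.ofReal p) volume := by
      refine eLpNorm_le_mul_eLpNorm_of_ae_le_mul (Eventually.of_forall fun x => ?_) _
      by_cases hx : x ∈ A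
      · rw [indicator_of_mem hx, norm_smul, mul_comm]
        gcongr
        exact hM _ hm x
      · rw [fderiv_cutoff_eq_zero hm hx, indicator_of_notMem hx]
        simp
    have e2 : eLpNorm (A.indicator w) (ENNReal.ofReal p) volume ≤
        eLpNorm w (ENNReal.ofReal (p * N / (N - p))) (volume.restrict (Metric.ball (0 : E N) (m + 1))ᶜ)
          * (ENNReal.ofReal (2 * (m + 1)) * volume (Metric.ball (0 : E N) 1) ^ (1 / (N : ℝ))) := by
      rw [eLpNorm_indicator_eq_eLpNorm_restrict hAm]
      refine (eLpNorm_le_eLpNorm_mul_rpow_measure_univ (ENNReal.ofReal_le_ofReal hpr)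
        hw.1.restrict).trans ?_
      rw [hexp]
      refine mul_le_mul' (eLpNorm_mono_measure _ (Measure.restrict_mono (fun x hx => hx.2) le_rfl)) ?_
      rw [Measure.restrict_apply_univ]
      calc volume A ^ (1 / (N : ℝ))
          ≤ (volume (Metric.closedBall (0 : E N) (2 * (m + 1)))) ^ (1 / (N : ℝ)) := by
            gcongr; exact sdiff_subset
        _ = _ := by
            rw [Measure.addHaar_closedBall _ _ (by positivity),
              ENNReal.mul_rpow_of_nonneg _ _ (by positivity),
              ENNReal.ofReal_rpow_of_nonneg (by positivity) (by positivity)]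
            congr 2
            rw [finrank_euclideanSpace, Fintype.card_fin, one_div,
              Real.pow_rpow_inv_natCast (by positivity) (by exact_mod_cast hN0.ne')]
    refine e1.trans ((mul_le_mul_right e2 _).trans (le_of_eq ?_))
    have : ENNReal.ofReal (2 * M) = ENNReal.ofReal (M / (m + 1)) * ENNReal.ofReal (2 * (m + 1)) := by
      rw [← ENNReal.ofReal_mul (by positivity)]
      congr 1
      field_simp
    rw [hc, this]
    ring
  have hlim := ENNReal.Tendsto.const_mul (a := c) (tendsto_eLpNorm_compl_ball hr hw)
    (Or.inr hct)
  rw [mul_zero] at hlim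
  exact tendsto_of_tendsto_of_tendsto_of_le_of_le tendsto_const_nhds hlim (fun _ => zero_le)
    key

/-! ### Approximation in `D^{1,p}` and the Sobolev inequality -/

theorem weakGradient_spec {u : E N → ℝ} (h : HasWeakGradient u) :
    IsWeakGradient u (weakGradient u) := by
  rw [weakGradient, dif_pos h]
  exact h.choose_spec

/-- Functions of `D^{1,p}` are approximated by compactly supported `C¹` functions, radial if the
given function is radial. -/
theorem MemD.exists_approx {p : ℝ} (hp : 1 < p) (hpN : p < N) {u : E N → ℝ} (hu : MemD p u) :
    ∃ v : ℕ → E N → ℝ, (∀ n, ContDiff ℝ 1 (v n)) ∧ (∀ n, HasCompactSupport (v n)) ∧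
      (∀ n : ℕ, eLpNorm (fderiv ℝ (v n)) (ENNReal.ofReal p) volume ≤
        eLpNorm (weakGradient u) (ENNReal.ofReal p) volume + ((n : ℝ≥0∞) + 1)⁻¹) ∧
      (∀ᵐ x, Tendsto (fun n => v n x) atTop (𝓝 (u x))) ∧
      (IsRadial u → ∀ n x y, ‖x‖ = ‖y‖ → v n x = v n y) := by
  have hg := weakGradient_spec hu.2.1
  have hNp : (0 : ℝ) < N - p := by linarith
  have hpr : 1 ≤ p * N / (N - p) := by
    rw [le_div_iff₀ hNp]; nlinarith
  set ε : ℕ → ℝ := fun n => 1 / ((n : ℝ) + 1) with hεdef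
  have hε : ∀ n, 0 < ε n := fun n => by positivity
  have hεt : Tendsto ε atTop (𝓝 0) := tendsto_one_div_add_atTop_nhds_zero_nat
  set w : ℕ → E N → ℝ := fun n => regularize (ε n) u with hw
  have hwC : ∀ n, ContDiff ℝ 1 (w n) := fun n => regularize_contDiff (hε n) hg.1
  have hwL : ∀ n, MemLp (w n) (ENNReal.ofReal (p * N / (N - p))) volume := fun n =>
    ⟨(hwC n).continuous.aestronglyMeasurable,
      (eLpNorm_le_of_enorm_le_mollify hpr (hε n) hu.1.1
        (enorm_regularize_le (hε n) u)).trans_lt hu.1.2⟩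
  have hwG : ∀ n, eLpNorm (fderiv ℝ (w n)) (ENNReal.ofReal p) volume ≤
      eLpNorm (weakGradient u) (ENNReal.ofReal p) volume := fun n =>
    eLpNorm_le_of_enorm_le_mollify hp.le (hε n) hu.2.2.1 (enorm_fderiv_regularize_le (hε n) hg)
  -- The cutoff radius depends on the mollified function; `n ≤ m` ensures that each fixed point
  -- eventually lies where the cutoff equals `1`.
  have hm : ∀ n : ℕ, ∃ m : ℕ, n ≤ m ∧
      eLpNorm (fun x => w n x • fderiv ℝ (cutoff N (m + 1)) x) (ENNReal.ofReal p) volume ≤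
        ((n : ℝ≥0∞) + 1)⁻¹ := fun n => by
    have h := (tendsto_eLpNorm_smul_fderiv_cutoff hp hpN (hwL n)).eventually_le_const
      (u := ((n : ℝ≥0∞) + 1)⁻¹) (by simp)
    obtain ⟨m, h1, h2⟩ := (h.and (eventually_ge_atTop n)).exists
    exact ⟨m, h2, h1⟩
  choose m hnm hm using hm
  have hm0 : ∀ n, (0 : ℝ) < m n + 1 := fun n => by positivity
  have hcC : ∀ n, ContDiff ℝ 1 (cutoff N (m n + 1)) := fun n =>
    (cutoff_contDiff N _).of_le (by simp)
  refine ⟨fun n x => cutoff N (m n + 1) x * w n x, fun n => (hcC n).mul (hwC n),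
    fun n => (cutoff_hasCompactSupport (hm0 n)).mul_right, fun n => ?_, ?_, ?_⟩
  · have hfd : fderiv ℝ (fun x => cutoff N (m n + 1) x * w n x) =
        (fun x => cutoff N (m n + 1) x • fderiv ℝ (w n) x) +
          fun x => w n x • fderiv ℝ (cutoff N (m n + 1)) x := by
      ext1 x
      exact fderiv_fun_mul ((hcC n).differentiable one_ne_zero x)
        ((hwC n).differentiable one_ne_zero x)
    rw [hfd]
    have hc1 := (hcC n).continuous.smul ((hwC n).continuous_fderiv one_ne_zero)
    have hc2 := (hwC n).continuous.smul ((hcC n).continuous_fderiv one_ne_zero)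
    refine (eLpNorm_add_le hc1.aestronglyMeasurable hc2.aestronglyMeasurable
      (by simpa using hp.le)).trans (add_le_add ?_ (hm n))
    refine le_trans (eLpNorm_mono fun x => ?_) (hwG n)
    rw [Pi.smul_apply', norm_smul]
    refine mul_le_of_le_one_left (norm_nonneg _) ?_
    rw [cutoff, Real.norm_of_nonneg (Real.smoothTransition.nonneg _)]
    exact Real.smoothTransition.le_one _
  · filter_upwards [ae_tendsto_regularize hg.1 hε hεt] with x hx
    refine hx.congr' ?_
    obtain ⟨k, hk⟩ := exists_nat_ge ‖x‖
    filter_upwards [eventually_ge_atTop k] with n hn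
    rw [cutoff_eq_one (hm0 n), one_mul]
    have : (k : ℝ) ≤ m n := by exact_mod_cast hn.trans (hnm n)
    linarith
  · intro hr n x y hxy
    simp only [hw]
    rw [cutoff_congr _ hxy, regularize_radial hr hxy]

theorem tendsto_const_add_inv (a : ℝ≥0∞) :
    Tendsto (fun n : ℕ => a + ((n : ℝ≥0∞) + 1)⁻¹) atTop (𝓝 a) := by
  have h : Tendsto (fun n : ℕ => ((n : ℝ≥0∞) + 1)⁻¹) atTop (𝓝 0) := by
    have := (tendsto_add_atTop_iff_nat 1).2 ENNReal.tendsto_inv_nat_nhds_zero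
    simpa using this
  simpa using h.const_add a

/-- The Sobolev inequality on `D^{1,p}`. -/
theorem exists_sobolev_const {p : ℝ} (hp : 1 < p) (hpN : p < N) :
    ∃ C : ℝ≥0∞, C ≠ ⊤ ∧ ∀ u : E N → ℝ, MemD p u →
      eLpNorm u (ENNReal.ofReal (p * N / (N - p))) volume ≤
        C * eLpNorm (weakGradient u) (ENNReal.ofReal p) volume := by
  have hN0 : (0 : ℝ) < N := by linarith
  have hNp : (0 : ℝ) < N - p := by linarith
  refine ⟨eLpNormLESNormFDerivOfEqInnerConst (volume : Measure (E N)) (p.toNNReal : ℝ),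
    ENNReal.coe_ne_top, fun u hu => ?_⟩
  obtain ⟨v, hv, hvc, hvg, hvt, -⟩ := hu.exists_approx hp hpN
  -- Fatou's lemma carries the Gagliardo–Nirenberg–Sobolev inequality over from the approximants
  -- with the same constant, since their gradient norms exceed that of `u` by at most `1/(n+1)`.
  refine (Lp.eLpNorm_lim_le_liminf_eLpNorm
    (fun n => (hv n).continuous.aestronglyMeasurable) u hvt).trans ?_
  have hlim := ENNReal.Tendsto.const_mul
    (a := (eLpNormLESNormFDerivOfEqInnerConst (volume : Measure (E N)) (p.toNNReal : ℝ) : ℝ≥0∞))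
    (tendsto_const_add_inv (eLpNorm (weakGradient u) (ENNReal.ofReal p) volume))
    (Or.inr ENNReal.coe_ne_top)
  refine le_trans (liminf_le_liminf (Eventually.of_forall fun n => ?_)) hlim.liminf_eq.le
  refine le_trans ?_ (mul_le_mul_right (hvg n) _)
  refine eLpNorm_le_eLpNorm_fderiv_of_eq_inner volume (hv n) (hvc n) (p := p.toNNReal)
    (p' := (p * N / (N - p)).toNNReal) (by simpa using hp.le)
    (by simpa using hN0) ?_
  rw [Real.coe_toNNReal _ (by positivity), NNReal.coe_inv, Real.coe_toNNReal _ (by linarith),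
    finrank_euclideanSpace, Fintype.card_fin]
  field_simp

/-! ### Pointwise decay of radial functions -/

theorem norm_fderiv_congr_of_radial {v : E N → ℝ} (hr : ∀ x y, ‖x‖ = ‖y‖ → v x = v y)
    {x y : E N} (h : ‖x‖ = ‖y‖) : ‖fderiv ℝ v x‖ = ‖fderiv ℝ v y‖ := by
  set T := Submodule.reflection (Submodule.span ℝ {x - y})ᗮ with hT
  have hTx : T x = y := Submodule.reflection_sub h
  have hv : v ∘ T = v := funext fun z => hr _ _ (T.norm_map z)
  have h1 := T.toContinuousLinearEquiv.comp_right_fderiv (f := v) (x := x)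
  have h2 : v ∘ T.toContinuousLinearEquiv = v := hv
  rw [h2] at h1
  rw [h1]
  change ‖(fderiv ℝ v (T x)).comp _‖ = _
  rw [hTx]
  exact ContinuousLinearMap.opNorm_comp_linearIsometryEquiv _ T

theorem lintegral_Ioi_rpow {s r : ℝ} (hs : s < -1) (hr : 0 < r) :
    ∫⁻ y in Ioi r, ENNReal.ofReal (y ^ s) = ENNReal.ofReal (r ^ (s + 1) * (-(s + 1))⁻¹) := by
  rw [← ofReal_integral_eq_lintegral_ofReal (integrableOn_Ioi_rpow_of_lt hs hr)
    ((ae_restrict_mem measurableSet_Ioi).mono fun y hy =>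
      Real.rpow_nonneg (hr.trans hy).le _), integral_Ioi_rpow_of_lt hs hr]
  congr 1
  rw [inv_neg, mul_neg, ← div_eq_mul_inv, neg_div]

/-- Polar coordinates for the energy of a compactly supported radial function. -/
theorem lintegral_profile_eq (hN : 1 ≤ N) {p : ℝ} (hp : 1 < p) {v : E N → ℝ}
    (hv : ContDiff ℝ 1 v) (hvc : HasCompactSupport v) {G : ℝ → ℝ}
    (hG : ∀ x, ‖fderiv ℝ v x‖ = G ‖x‖) :
    ENNReal.ofReal (N * volume.real (Metric.ball (0 : E N) 1)) *
        ∫⁻ y in Ioi (0 : ℝ), ENNReal.ofReal (y ^ (N - 1) * G y ^ p) =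
      ∫⁻ x, ‖fderiv ℝ v x‖ₑ ^ p := by
  have : Nonempty (Fin N) := ⟨⟨0, hN⟩⟩
  have : Nontrivial (E N) := inferInstance
  have hp0 : 0 < p := by linarith
  have hint : Integrable (fun x => ‖fderiv ℝ v x‖ ^ p) volume := by
    refine Continuous.integrable_of_hasCompactSupport
      (((hv.continuous_fderiv one_ne_zero).norm).rpow_const fun _ => Or.inr hp0.le) ?_
    refine (hvc.fderiv (𝕜 := ℝ)).comp_left (g := fun L => ‖L‖ ^ p) ?_
    simp [hp0.ne']
  have hG0 : ∀ y, 0 ≤ y → 0 ≤ G y := by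
    intro y hy
    obtain ⟨e, he⟩ := exists_norm_eq (E N) hy
    rw [← he, ← hG]
    exact norm_nonneg _
  have hfun : (fun x => ‖fderiv ℝ v x‖ ^ p) = fun x : E N => (fun y => G y ^ p) ‖x‖ := by
    ext x; rw [hG]
  have hint' := (integrable_fun_norm_addHaar (volume : Measure (E N)) (f := fun y => G y ^ p)).1
    (hfun ▸ hint)
  have hI := integral_fun_norm_addHaar (volume : Measure (E N)) (fun y => G y ^ p)
  simp only [smul_eq_mul, finrank_euclideanSpace, Fintype.card_fin, nsmul_eq_mul] at hI hint'
  rw [← ofReal_integral_eq_lintegral_ofReal hint'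
    ((ae_restrict_mem measurableSet_Ioi).mono fun y hy => mul_nonneg
      (pow_nonneg (le_of_lt hy) _) (Real.rpow_nonneg (hG0 y (le_of_lt hy)) _)),
    ← ENNReal.ofReal_mul (by positivity), mul_assoc, ← hI, ← hfun,
    ofReal_integral_eq_lintegral_ofReal hint (Eventually.of_forall fun x => by positivity)]
  refine lintegral_congr fun x => ?_
  rw [← ofReal_norm, ENNReal.ofReal_rpow_of_nonneg (norm_nonneg _) hp0.le]

theorem enorm_le_lintegral_of_hasCompactSupport {F : ℝ → ℝ} (hF : ContDiff ℝ 1 F)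
    (hFc : HasCompactSupport F) (r : ℝ) : ‖F r‖ₑ ≤ ∫⁻ y in Ioi r, ‖deriv F y‖ₑ := by
  have h := hFc.integral_Ioi_deriv_eq hF r
  calc ‖F r‖ₑ = ‖∫ y in Ioi r, deriv F y‖ₑ := by rw [h, enorm_neg]
    _ ≤ _ := enorm_integral_le_lintegral_enorm _

/-- Along a ray, `|F r| ≤ ∫_r^∞ |F'|`. Hölder against the polar weight `y^(N-1)` leaves the integral
of `y^s` over `(r, ∞)` with `s = -(N-1)/(p-1)`. It converges precisely because `p < N`, and its
power `1 - 1/p` gives `r^(-(N-p)/p)`. -/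
theorem exists_radial_const_of_contDiff {p : ℝ} (hp : 1 < p) (hpN : p < N) :
    ∃ C : ℝ≥0∞, C ≠ ⊤ ∧ ∀ v : E N → ℝ, ContDiff ℝ 1 v → HasCompactSupport v →
      (∀ x y, ‖x‖ = ‖y‖ → v x = v y) → ∀ x, x ≠ 0 →
      ‖v x‖ₑ ≤ C * ENNReal.ofReal (‖x‖ ^ (-((N - p) / p))) *
        eLpNorm (fderiv ℝ v) (ENNReal.ofReal p) volume := by
  have hp0 : 0 < p := by linarith
  have hN1 : 1 ≤ N := by
    rcases Nat.eq_zero_or_pos N with h | h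
    · subst h; norm_num at hpN; linarith
    · exact h
  have hcast : ((N - 1 : ℕ) : ℝ) = N - 1 := by push_cast [hN1]; ring
  have hnt : Nonempty (Fin N) := ⟨⟨0, hN1⟩⟩
  have hnt : Nontrivial (E N) := inferInstance
  set s : ℝ := -((N - 1) / (p - 1)) with hs
  have hs1 : s < -1 := by
    rw [hs, neg_lt_neg_iff, one_lt_div (by linarith)]; linarith
  have hs2 : 0 < (-(s + 1))⁻¹ := inv_pos.2 (by linarith)
  set κ : ℝ := N * volume.real (Metric.ball (0 : E N) 1) with hκ
  have hκ0 : 0 < κ := mul_pos (by linarith)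
    (ENNReal.toReal_pos (Metric.measure_ball_pos _ _ one_pos).ne' measure_ball_lt_top.ne)
  have hq : 0 ≤ 1 - 1 / p := by rw [sub_nonneg, div_le_one hp0]; exact hp.le
  refine ⟨ENNReal.ofReal (κ⁻¹) ^ (1 / p) * ENNReal.ofReal ((-(s + 1))⁻¹) ^ (1 - 1 / p),
    ENNReal.mul_ne_top (ENNReal.rpow_ne_top_of_nonneg (by positivity) ENNReal.ofReal_ne_top)
      (ENNReal.rpow_ne_top_of_nonneg hq ENNReal.ofReal_ne_top), ?_⟩
  intro v hv hvc hvr x hx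
  have hr : 0 < ‖x‖ := norm_pos_iff.2 hx
  set r := ‖x‖ with hrdef
  set e : E N := r⁻¹ • x with he
  have he1 : ‖e‖ = 1 := by rw [he, norm_smul, norm_inv, norm_norm, ← hrdef, inv_mul_cancel₀ hr.ne']
  -- The gradient norm of a radial function is radial, so its values along one ray determine the
  -- whole energy.
  set G : ℝ → ℝ := fun t => ‖fderiv ℝ v (t • e)‖ with hGdef
  have hG : ∀ z, ‖fderiv ℝ v z‖ = G ‖z‖ := fun z =>
    norm_fderiv_congr_of_radial hvr (by simp [norm_smul, he1])
  have hGc : Continuous G :=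
    ((hv.continuous_fderiv one_ne_zero).comp (continuous_id.smul continuous_const)).norm
  have hpol := lintegral_profile_eq hN1 hp hv hvc hG
  set F : ℝ → ℝ := fun t => v (t • e) with hF
  have hFC : ContDiff ℝ 1 F := hv.comp (contDiff_id.smul contDiff_const)
  have hFc : HasCompactSupport F := by
    obtain ⟨R, hR⟩ := hvc.isCompact.isBounded.subset_closedBall (0 : E N)
    refine HasCompactSupport.intro (isCompact_closedBall (0 : ℝ) R) fun t ht => ?_
    refine (image_eq_zero_of_notMem_tsupport fun hm => ht ?_ : v (t • e) = 0)
    have := hR hm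
    simpa [norm_smul, he1] using this
  have hFd : ∀ t, ‖deriv F t‖ₑ ≤ ENNReal.ofReal (G t) := by
    intro t
    have hd : HasDerivAt F (fderiv ℝ v (t • e) e) t := by
      have h1 := (hv.differentiable one_ne_zero (t • e)).hasFDerivAt
      have h2 : HasDerivAt (fun t : ℝ => t • e) e t := by
        simpa using (hasDerivAt_id t).smul_const e
      exact h1.comp_hasDerivAt t h2
    rw [hd.deriv, ← ofReal_norm]
    refine ENNReal.ofReal_le_ofReal ?_
    simpa [he1] using (fderiv ℝ v (t • e)).le_opNorm e
  have hvF : v x = F r := by rw [hF, he]; simp [smul_smul, mul_inv_cancel₀ hr.ne']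
  have hH := ENNReal.lintegral_mul_norm_pow_le (μ := volume.restrict (Ioi r))
    (f := fun y => ENNReal.ofReal (y ^ (N - 1) * G y ^ p)) (g := fun y => ENNReal.ofReal (y ^ s))
    ((by fun_prop (disch := positivity) : Measurable fun y : ℝ => y ^ (N - 1) * G y ^ p).ennreal_ofReal.aemeasurable)
    ((by fun_prop : Measurable fun y : ℝ => y ^ s).ennreal_ofReal.aemeasurable)
    (p := 1 / p) (q := 1 - 1 / p) (by positivity) hq (by ring)
  rw [lintegral_Ioi_rpow hs1 hr] at hH
  have hpt : ∀ y ∈ Ioi r, ENNReal.ofReal (y ^ (N - 1) * G y ^ p) ^ (1 / p) *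
      ENNReal.ofReal (y ^ s) ^ (1 - 1 / p) = ENNReal.ofReal (G y) := by
    intro y hy
    have hy0 : 0 < y := hr.trans hy
    have hGy : 0 ≤ G y := norm_nonneg _
    rw [ENNReal.ofReal_rpow_of_nonneg (by positivity) (by positivity),
      ENNReal.ofReal_rpow_of_nonneg (by positivity) hq, ← ENNReal.ofReal_mul (by positivity),
      Real.mul_rpow (by positivity) (by positivity), ← Real.rpow_mul hGy,
      mul_one_div_cancel hp0.ne', Real.rpow_one, ← Real.rpow_natCast, ← Real.rpow_mul hy0.le,
      ← Real.rpow_mul hy0.le, mul_right_comm, ← Real.rpow_add hy0, hcast]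
    have : ((N : ℝ) - 1) * (1 / p) + s * (1 - 1 / p) = 0 := by
      have : p - 1 ≠ 0 := by linarith
      rw [hs]; field_simp; ring
    rw [this, Real.rpow_zero, one_mul]
  rw [setLIntegral_congr_fun measurableSet_Ioi hpt] at hH
  have hpol' : ∫⁻ y in Ioi r, ENNReal.ofReal (y ^ (N - 1) * G y ^ p) ≤
      ENNReal.ofReal κ⁻¹ * ∫⁻ z, ‖fderiv ℝ v z‖ₑ ^ p := by
    rw [← hpol, ← mul_assoc, ← ENNReal.ofReal_mul (by positivity), inv_mul_cancel₀ hκ0.ne',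
      ENNReal.ofReal_one, one_mul]
    exact lintegral_mono_set (Ioi_subset_Ioi hr.le)
  rw [eLpNorm_eq_lintegral_rpow_enorm_toReal (by simpa using hp0) ENNReal.ofReal_ne_top,
    ENNReal.toReal_ofReal hp0.le, hvF]
  calc ‖F r‖ₑ ≤ ∫⁻ y in Ioi r, ‖deriv F y‖ₑ := enorm_le_lintegral_of_hasCompactSupport hFC hFc r
    _ ≤ ∫⁻ y in Ioi r, ENNReal.ofReal (G y) := lintegral_mono fun y => hFd y
    _ ≤ _ := hH
    _ ≤ (ENNReal.ofReal κ⁻¹ * ∫⁻ z, ‖fderiv ℝ v z‖ₑ ^ p) ^ (1 / p) *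
          ENNReal.ofReal (r ^ (s + 1) * (-(s + 1))⁻¹) ^ (1 - 1 / p) := by gcongr
    _ = _ := by
      have h1 : r ^ (-((N - p) / p)) = (r ^ (s + 1)) ^ (1 - 1 / p) := by
        rw [← Real.rpow_mul hr.le]
        congr 1
        have : p - 1 ≠ 0 := by linarith
        rw [hs]; field_simp; ring
      rw [h1, ENNReal.mul_rpow_of_nonneg _ _ (by positivity), ENNReal.ofReal_mul (by positivity),
        ENNReal.mul_rpow_of_nonneg _ _ hq,
        ENNReal.ofReal_rpow_of_nonneg (x := r ^ (s + 1)) (by positivity) hq]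
      ring

/-- The pointwise decay of radial functions of `D^{1,p}`. -/
theorem exists_radial_const {p : ℝ} (hp : 1 < p) (hpN : p < N) :
    ∃ C : ℝ≥0∞, C ≠ ⊤ ∧ ∀ u : E N → ℝ, MemD p u → IsRadial u → ∀ᵐ x,
      ‖u x‖ₑ ≤ C * ENNReal.ofReal (‖x‖ ^ (-((N - p) / p))) *
        eLpNorm (weakGradient u) (ENNReal.ofReal p) volume := by
  obtain ⟨C, hC, h⟩ := exists_radial_const_of_contDiff hp hpN
  have hN1 : 1 ≤ N := by
    rcases Nat.eq_zero_or_pos N with h | h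
    · subst h; norm_num at hpN; linarith
    · exact h
  have hnt : Nonempty (Fin N) := ⟨⟨0, hN1⟩⟩
  have hnt : Nontrivial (E N) := inferInstance
  refine ⟨C, hC, fun u hu hur => ?_⟩
  obtain ⟨v, hv, hvc, hvg, hvt, hvr⟩ := hu.exists_approx hp hpN
  have h0 : ∀ᵐ x : E N, x ≠ 0 := Measure.ae_ne volume 0
  filter_upwards [hvt, h0] with x hx hx0
  refine le_of_tendsto_of_tendsto' hx.enorm (ENNReal.Tendsto.const_mul
    (tendsto_const_add_inv (eLpNorm (weakGradient u) (ENNReal.ofReal p) volume))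
    (Or.inr (ENNReal.mul_ne_top hC ENNReal.ofReal_ne_top))) fun n => ?_
  exact (h (v n) (hv n) (hvc n) (hvr hur n) x hx0).trans (mul_le_mul_right (hvg n) _)

/-! ### The Hölder estimate near infinity -/

variable {p : ℝ} {V : ℝ → ℝ≥0∞} {u h : E N → ℝ}

theorem lintegral_le_one_of_normW_eq_one (hp : 0 < p) (hu : normW p V u = 1) :
    ∫⁻ x, (‖weakGradient u x‖ₑ ^ p + V ‖x‖ * ‖u x‖ₑ ^ p) ≤ 1 := by
  rw [normW] at hu
  have := congrArg (· ^ p) hu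
  simp only [← ENNReal.rpow_mul, one_div_mul_cancel hp.ne', ENNReal.rpow_one,
    ENNReal.one_rpow] at this
  exact this.le

theorem eLpNorm_weakGradient_le_one (hp : 0 < p) (hu : normW p V u = 1) :
    eLpNorm (weakGradient u) (ENNReal.ofReal p) volume ≤ 1 := by
  rw [eLpNorm_eq_lintegral_rpow_enorm_toReal (by simpa using hp) ENNReal.ofReal_ne_top,
    ENNReal.toReal_ofReal hp.le]
  refine ENNReal.rpow_le_one ?_ (by positivity)
  exact (lintegral_mono fun x => le_self_add).trans (lintegral_le_one_of_normW_eq_one hp hu)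

theorem lintegral_potential_le_one (hp : 0 < p) (hu : normW p V u = 1) :
    ∫⁻ x, V ‖x‖ * ‖u x‖ₑ ^ p ≤ 1 :=
  (lintegral_mono fun _ => le_add_self).trans (lintegral_le_one_of_normW_eq_one hp hu)

/-- The essential bound on the weights, in multiplicative form. -/
theorem ae_weight_le {K : ℝ → ℝ} (hK : ∀ r, 0 < r → 0 < K r) {R₂ α β : ℝ} (hR₂ : 0 < R₂)
    (hVfin : ∀ᵐ r ∂(volume.restrict (Ioi R₂)), V r < ⊤) (hβ₀ : 0 ≤ β)
    (hess : essSup (fun r : ℝ => ENNReal.ofReal (K r) / (ENNReal.ofReal r ^ α * V r ^ β))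
      (volume.restrict (Ioi R₂)) < ⊤) :
    ∀ᵐ r ∂(volume.restrict (Ioi R₂)), ENNReal.ofReal (K r) ≤
      essSup (fun r : ℝ => ENNReal.ofReal (K r) / (ENNReal.ofReal r ^ α * V r ^ β))
        (volume.restrict (Ioi R₂)) * (ENNReal.ofReal r ^ α * V r ^ β) := by
  filter_upwards [ENNReal.ae_le_essSup
    (fun r : ℝ => ENNReal.ofReal (K r) / (ENNReal.ofReal r ^ α * V r ^ β)),
    hVfin, ae_restrict_mem measurableSet_Ioi] with r h1 h2 h3
  have hr : 0 < r := hR₂.trans h3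
  have hDt : ENNReal.ofReal r ^ α * V r ^ β ≠ ⊤ :=
    ENNReal.mul_ne_top (by rw [ENNReal.ofReal_rpow_of_pos hr]; exact ENNReal.ofReal_ne_top)
      (ENNReal.rpow_ne_top_of_nonneg hβ₀ h2.ne)
  -- At a zero of the denominator the quotient is `⊤`, since `K r > 0`; this contradicts the finite
  -- essential supremum.
  have hD0 : ENNReal.ofReal r ^ α * V r ^ β ≠ 0 := by
    intro h0
    have hk : ENNReal.ofReal (K r) ≠ 0 := by simpa using hK r hr
    simp only [h0, ENNReal.div_zero hk] at h1
    exact hess.ne (top_le_iff.1 h1)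
  exact (ENNReal.div_le_iff hD0 hDt).1 h1

/-- Null sets of radii give null sets of points. -/
theorem ae_norm_of_ae_Ioi (hN : 1 ≤ N) {R : ℝ} {P : ℝ → Prop}
    (h : ∀ᵐ r ∂(volume.restrict (Ioi R)), P r) : ∀ᵐ x : E N, R < ‖x‖ → P ‖x‖ :=
  (quasiMeasurePreserving_norm hN).ae
    (ae_restrict_of_ae ((ae_restrict_iff' measurableSet_Ioi).1 h))

/-- Outside the unit ball `1 + ‖x‖ ≤ 2 ‖x‖`, which reduces the claim to the integrability of `(1 +
‖x‖)^(-s)`. -/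
theorem lintegral_norm_rpow_compl_ball_lt_top {s : ℝ} (hs : N < s) :
    ∫⁻ x in (Metric.ball (0 : E N) 1)ᶜ, ENNReal.ofReal (‖x‖ ^ (-s)) < ⊤ := by
  have hs0 : 0 < s := lt_of_le_of_lt (Nat.cast_nonneg N) hs
  have h1 := finite_integral_one_add_norm (E := E N) (μ := volume) (r := s) (by simpa using hs)
  have h2 : ∫⁻ x in (Metric.ball (0 : E N) 1)ᶜ, ENNReal.ofReal (‖x‖ ^ (-s)) ≤
      ∫⁻ x : E N, ENNReal.ofReal (2 ^ s) * ENNReal.ofReal ((1 + ‖x‖) ^ (-s)) := by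
    refine (setLIntegral_mono_ae' measurableSet_ball.compl
      (Eventually.of_forall fun x hx => ?_)).trans (setLIntegral_le_lintegral _ _)
    have hx1 : 1 ≤ ‖x‖ := by simpa using hx
    rw [← ENNReal.ofReal_mul (by positivity)]
    refine ENNReal.ofReal_le_ofReal ?_
    rw [Real.rpow_neg (by positivity), Real.rpow_neg (by positivity), ← div_eq_mul_inv,
      ← Real.div_rpow (by positivity) (by positivity), ← Real.inv_rpow (by positivity)]
    refine Real.rpow_le_rpow (by positivity) ?_ hs0.le
    rw [inv_eq_one_div, div_le_div_iff₀ (by positivity) (by positivity)]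
    linarith
  refine h2.trans_lt ?_
  rw [lintegral_const_mul' _ _ ENNReal.ofReal_ne_top]
  exact ENNReal.mul_lt_top ENNReal.ofReal_lt_top h1

/-- Redistribution of the powers of the integrand among the Hölder factors. -/
theorem weight_mul_rpow_le {Λ C k v X Y : ℝ≥0∞} {p α β q a b m pstar γ θ s δ r R : ℝ}
    (hp : 0 < p) (hpstar : 0 < pstar) (ha0 : 0 ≤ a) (ha1 : a ≤ 1) (hb : 0 ≤ b)
    (hbq : b ≤ q - 1) (hab : a + b = p * β) (hr : 1 ≤ r) (hRr : R ≤ r) (hR : 0 < R) (hδ : 0 ≤ δ)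
    (hγ : γ = α - m * (q - 1 - b)) (hγθ : γ + s * θ ≤ -δ)
    (hk : k ≤ Λ * (ENNReal.ofReal r ^ α * v ^ β))
    (hX : X ≤ C * ENNReal.ofReal (r ^ (-m))) :
    k * X ^ (q - 1) * Y ≤ Λ * C ^ (q - 1 - b) * ENNReal.ofReal (R ^ (-δ)) *
      ((v * Y ^ p) ^ (a / p) * (Y ^ pstar) ^ ((1 - a) / pstar) * (v * X ^ p) ^ (b / p) *
        ENNReal.ofReal (r ^ (-s)) ^ θ) := by
  have hr0 : 0 < r := by linarith
  have hd : 0 ≤ q - 1 - b := by linarith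
  have e1 : X ^ (q - 1) = X ^ b * X ^ (q - 1 - b) := by
    rw [← ENNReal.rpow_add_of_nonneg _ _ hb hd]; congr 1; ring
  have e2 : Y = Y ^ a * Y ^ (1 - a) := by
    rw [← ENNReal.rpow_add_of_nonneg _ _ ha0 (by linarith)]; simp
  have e3 : v ^ β = v ^ (a / p) * v ^ (b / p) := by
    rw [← ENNReal.rpow_add_of_nonneg _ _ (by positivity) (by positivity), ← add_div, hab,
      mul_div_cancel_left₀ _ hp.ne']
  have e4 : (v * Y ^ p) ^ (a / p) = v ^ (a / p) * Y ^ a := by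
    rw [ENNReal.mul_rpow_of_nonneg _ _ (by positivity), ← ENNReal.rpow_mul,
      mul_div_cancel₀ _ hp.ne']
  have e5 : (v * X ^ p) ^ (b / p) = v ^ (b / p) * X ^ b := by
    rw [ENNReal.mul_rpow_of_nonneg _ _ (by positivity), ← ENNReal.rpow_mul,
      mul_div_cancel₀ _ hp.ne']
  have e6 : (Y ^ pstar) ^ ((1 - a) / pstar) = Y ^ (1 - a) := by
    rw [← ENNReal.rpow_mul, mul_div_cancel₀ _ hpstar.ne']
  -- The total exponent of `r` is `γ ≤ -δ - sθ`, and `r ≥ 1`; then `r^(-δ) ≤ R^(-δ)`.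
  have e7 : ENNReal.ofReal r ^ α * ENNReal.ofReal (r ^ (-m)) ^ (q - 1 - b) ≤
      ENNReal.ofReal (R ^ (-δ)) * ENNReal.ofReal (r ^ (-s)) ^ θ := by
    rw [ENNReal.ofReal_rpow_of_pos hr0, ENNReal.ofReal_rpow_of_pos (by positivity),
      ENNReal.ofReal_rpow_of_pos (by positivity), ← ENNReal.ofReal_mul (by positivity),
      ← ENNReal.ofReal_mul (by positivity), ← Real.rpow_mul hr0.le, ← Real.rpow_mul hr0.le,
      ← Real.rpow_add hr0]
    refine ENNReal.ofReal_le_ofReal ?_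
    calc r ^ (α + -m * (q - 1 - b)) ≤ r ^ (-δ + -s * θ) :=
          Real.rpow_le_rpow_of_exponent_le hr (by linarith)
      _ = r ^ (-δ) * r ^ (-s * θ) := Real.rpow_add hr0 _ _
      _ ≤ R ^ (-δ) * r ^ (-s * θ) := by
          gcongr ?_ * _
          exact Real.rpow_le_rpow_of_nonpos hR hRr (by linarith)
  calc k * X ^ (q - 1) * Y
      = k * (X ^ b * X ^ (q - 1 - b)) * (Y ^ a * Y ^ (1 - a)) := by rw [← e1, ← e2]
    _ ≤ (Λ * (ENNReal.ofReal r ^ α * v ^ β)) *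
          (X ^ b * (C * ENNReal.ofReal (r ^ (-m))) ^ (q - 1 - b)) * (Y ^ a * Y ^ (1 - a)) := by
        gcongr
    _ = (ENNReal.ofReal r ^ α * ENNReal.ofReal (r ^ (-m)) ^ (q - 1 - b)) *
          (Λ * C ^ (q - 1 - b) * (v ^ (a / p) * Y ^ a * Y ^ (1 - a) * (v ^ (b / p) * X ^ b))) := by
        rw [ENNReal.mul_rpow_of_nonneg _ _ hd, e3]; ring
    _ ≤ (ENNReal.ofReal (R ^ (-δ)) * ENNReal.ofReal (r ^ (-s)) ^ θ) *
          (Λ * C ^ (q - 1 - b) * (v ^ (a / p) * Y ^ a * Y ^ (1 - a) * (v ^ (b / p) * X ^ b))) := by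
        gcongr
    _ = _ := by rw [e4, e5, e6]; ring

/-- Hölder's inequality with four factors. -/
theorem lintegral_mul_four_rpow_le {X : Type*} [MeasurableSpace X] {μ : Measure X}
    {f₁ f₂ f₃ f₄ : X → ℝ≥0∞} (h₁ : AEMeasurable f₁ μ) (h₂ : AEMeasurable f₂ μ)
    (h₃ : AEMeasurable f₃ μ) (h₄ : AEMeasurable f₄ μ) {t₁ t₂ t₃ t₄ : ℝ} (ht₁ : 0 ≤ t₁)
    (ht₂ : 0 ≤ t₂) (ht₃ : 0 ≤ t₃) (ht₄ : 0 ≤ t₄) (ht : t₁ + t₂ + t₃ + t₄ = 1) :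
    ∫⁻ x, f₁ x ^ t₁ * f₂ x ^ t₂ * f₃ x ^ t₃ * f₄ x ^ t₄ ∂μ ≤
      (∫⁻ x, f₁ x ∂μ) ^ t₁ * (∫⁻ x, f₂ x ∂μ) ^ t₂ * (∫⁻ x, f₃ x ∂μ) ^ t₃ *
        (∫⁻ x, f₄ x ∂μ) ^ t₄ := by
  have h := ENNReal.lintegral_prod_norm_pow_le (μ := μ) (Finset.univ : Finset (Fin 4))
    (f := ![f₁, f₂, f₃, f₄]) (p := ![t₁, t₂, t₃, t₄])
    (by intro i _; fin_cases i <;> assumption) (by simpa [Fin.sum_univ_four] using ht)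
    (by intro i _; fin_cases i <;> assumption)
  simpa [Fin.prod_univ_four] using h

/-- Quantitative decay of `R_∞(q, R)`. -/
theorem exists_RInfty_le (hp : 1 < p) (hpN : p < N) {K : ℝ → ℝ}
    (hV : AEMeasurable V (volume.restrict (Ioi 0))) (hK : ∀ r, 0 < r → 0 < K r)
    {R₂ : ℝ} (hR₂ : 0 < R₂) (hVfin : ∀ᵐ r ∂(volume.restrict (Ioi R₂)), V r < ⊤)
    {α β : ℝ} (hβ₀ : 0 ≤ β) (hβ₁ : β ≤ 1)
    (hess : essSup (fun r : ℝ => ENNReal.ofReal (K r) / (ENNReal.ofReal r ^ α * V r ^ β))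
      (volume.restrict (Ioi R₂)) < ⊤)
    {q : ℝ} (hq₁ : 1 < q) (hqβ : p * β < q) (hqs : qStar N p α β < q) :
    ∃ C : ℝ≥0∞, C ≠ ⊤ ∧ ∃ δ : ℝ, 0 < δ ∧ ∀ R, 1 ≤ R → R₂ < R →
      RInfty N p V K q R ≤ C * ENNReal.ofReal (R ^ (-δ)) := by
  have hp0 : 0 < p := by linarith
  have hN0 : (0 : ℝ) < N := by linarith
  have hNp : (0 : ℝ) < N - p := by linarith
  have hN1 : 1 ≤ N := by exact_mod_cast hN0
  obtain ⟨S, hS, hSob⟩ := exists_sobolev_const hp hpN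
  obtain ⟨C₁, hC₁, hRad⟩ := exists_radial_const hp hpN
  set Λ := essSup (fun r : ℝ => ENNReal.ofReal (K r) / (ENNReal.ofReal r ^ α * V r ^ β))
      (volume.restrict (Ioi R₂)) with hΛ
  have hw := ae_norm_of_ae_Ioi hN1 (ae_weight_le (α := α) hK hR₂ hVfin hβ₀ hess)
  -- `a` is the power of `|h|` paired with `V`. It is capped at `1` because `h` enters linearly; the
  -- excess `b` is taken from `|u|^(q-1)`.
  set a := min 1 (p * β) with ha
  set b := p * β - a with hb
  set pstar := p * N / (N - p) with hpstar
  have hps0 : 0 < pstar := by positivity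
  have ha0 : 0 ≤ a := le_min zero_le_one (by positivity)
  have ha1 : a ≤ 1 := min_le_left _ _
  have hb0 : 0 ≤ b := sub_nonneg.2 (min_le_right _ _)
  -- Either `a = 1` and `b = pβ - 1 < q - 1`, or `b = 0`: this is where `q > pβ` and `q > 1` enter.
  have hbq : b ≤ q - 1 := by
    rcases min_choice 1 (p * β) with h | h <;> rw [hb, ha, h] <;> linarith
  set θ := 1 - a / p - (1 - a) / pstar - b / p with hθ
  have hinv : (1 - a) / pstar = (1 - a) * (N - p) / (p * N) := by
    rw [hpstar, div_div_eq_mul_div]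
  have hθ0 : 0 ≤ θ := by
    have h1 : θ = 1 - β - (1 - a) / pstar := by
      rw [hθ, hb]; field_simp; ring
    rcases min_choice 1 (p * β) with h | h
    · have : a = 1 := h
      rw [h1, this]; simp [hβ₁]
    · have h2 : a = p * β := h
      have h3 : (1 - a) / pstar ≤ 1 - β := by
        -- After clearing denominators the difference of the two sides is `N(p - 1) + p(1 - pβ)`.
        rw [div_le_iff₀ hps0, hpstar, mul_div_assoc', le_div_iff₀ hNp, h2]
        rw [h2] at ha1
        nlinarith [mul_nonneg hN0.le (sub_nonneg.2 hp.le), mul_nonneg hp0.le (sub_nonneg.2 ha1)]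
      linarith
  have hθ1 : θ ≤ 1 := by
    have h1 : 0 ≤ a / p := by positivity
    have h2 : 0 ≤ b / p := by positivity
    have h3 : 0 ≤ (1 - a) / pstar := div_nonneg (by linarith) hps0.le
    linarith
  -- `2δ = ((N-p)/p)(q - q*)`, positive exactly when `q > q*`.
  set δ := (q * ((N - p) / p) - (α - p * β + N)) / 2 with hδ
  have hδ0 : 0 < δ := by
    rw [qStar, mul_div_assoc', div_lt_iff₀ hNp] at hqs
    have : α - p * β + N < q * ((N - p) / p) := by
      rw [mul_div_assoc', lt_div_iff₀ hp0]; linarith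
    rw [hδ]; linarith
  set γ := α - (N - p) / p * (q - 1 - b) with hγ
  have hγθ' : γ + N * θ = -(2 * δ) := by
    rw [hγ, hθ, hδ, hinv, hb]; field_simp; ring
  -- The left side is `-2δ + δθ`, so `θ ≤ 1` suffices. Using `N + δ` instead of `N` makes the fourth
  -- Hölder integral finite.
  have hγθ : γ + (N + δ) * θ ≤ -δ := by nlinarith
  set M := ∫⁻ x in (Metric.ball (0 : E N) 1)ᶜ, ENNReal.ofReal (‖x‖ ^ (-(N + δ))) with hM
  have hMt : M ≠ ⊤ := (lintegral_norm_rpow_compl_ball_lt_top (by linarith)).ne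
  refine ⟨Λ * C₁ ^ (q - 1 - b) * (S ^ (1 - a) * M ^ θ),
    ENNReal.mul_ne_top (ENNReal.mul_ne_top hess.ne
      (ENNReal.rpow_ne_top_of_nonneg (by linarith) hC₁))
      (ENNReal.mul_ne_top (ENNReal.rpow_ne_top_of_nonneg (by linarith) hS)
        (ENNReal.rpow_ne_top_of_nonneg hθ0 hMt)), δ, hδ0, fun R hR1 hRR₂ => ?_⟩
  rw [RInfty]
  refine iSup₂_le fun u h => iSup₂_le fun hu hh => iSup₂_le fun hu1 hh1 => ?_
  have hVm : AEMeasurable (fun x : E N => V ‖x‖) volume :=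
    hV.comp_quasiMeasurePreserving (quasiMeasurePreserving_norm hN1)
  have hum : AEMeasurable (fun x => ‖u x‖ₑ) volume := hu.1.1.1.1.enorm
  have hhm : AEMeasurable (fun x => ‖h x‖ₑ) volume := hh.1.1.1.enorm
  have hrad : ∀ᵐ x, ‖u x‖ₑ ≤ C₁ * ENNReal.ofReal (‖x‖ ^ (-((N - p) / p))) := by
    filter_upwards [hRad u hu.1.1 hu.2] with x hx
    refine hx.trans ?_
    simpa using mul_le_mul_right (eLpNorm_weakGradient_le_one hp0 hu1)
      (C₁ * ENNReal.ofReal (‖x‖ ^ (-((N - p) / p))))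
  have hstar : (∫⁻ x, ‖h x‖ₑ ^ pstar) ^ ((1 - a) / pstar) ≤ S ^ (1 - a) := by
    have h1 := hSob h hh.1
    rw [eLpNorm_eq_lintegral_rpow_enorm_toReal (by simpa using hps0) ENNReal.ofReal_ne_top,
      ENNReal.toReal_ofReal hps0.le] at h1
    have h2 := h1.trans (mul_le_mul_right (eLpNorm_weakGradient_le_one hp0 hh1) S)
    rw [mul_one] at h2
    have h3 := ENNReal.rpow_le_rpow h2 (sub_nonneg.2 ha1)
    rwa [← ENNReal.rpow_mul, one_div_mul_eq_div] at h3
  set B := (Metric.ball (0 : E N) R)ᶜ with hB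
  have hH := lintegral_mul_four_rpow_le (μ := volume.restrict B)
    (hVm.mul (hhm.pow_const p)).restrict (hhm.pow_const pstar).restrict
    (hVm.mul (hum.pow_const p)).restrict
    (by fun_prop : Measurable fun x : E N => ENNReal.ofReal (‖x‖ ^ (-(N + δ)))).aemeasurable
    (t₁ := a / p) (t₂ := (1 - a) / pstar) (t₃ := b / p) (t₄ := θ)
    (by positivity) (div_nonneg (by linarith) hps0.le) (by positivity) hθ0 (by rw [hθ]; ring)
  have hpt : ∀ᵐ x : E N, x ∈ B → ENNReal.ofReal (K ‖x‖) * ‖u x‖ₑ ^ (q - 1) * ‖h x‖ₑ ≤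
      Λ * C₁ ^ (q - 1 - b) * ENNReal.ofReal (R ^ (-δ)) *
        ((V ‖x‖ * ‖h x‖ₑ ^ p) ^ (a / p) * (‖h x‖ₑ ^ pstar) ^ ((1 - a) / pstar) *
          (V ‖x‖ * ‖u x‖ₑ ^ p) ^ (b / p) * ENNReal.ofReal (‖x‖ ^ (-(N + δ))) ^ θ) := by
    filter_upwards [hrad, hw] with x hx1 hx2 hxB
    have hxR : R ≤ ‖x‖ := by simpa [hB] using hxB
    exact weight_mul_rpow_le hp0 hps0 ha0 ha1 hb0 hbq (by rw [hb]; ring) (hR1.trans hxR) hxR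
      (by linarith) hδ0.le hγ hγθ (hx2 (hRR₂.trans_le hxR)) hx1
  have hct : Λ * C₁ ^ (q - 1 - b) * ENNReal.ofReal (R ^ (-δ)) ≠ ⊤ :=
    ENNReal.mul_ne_top (ENNReal.mul_ne_top hess.ne
      (ENNReal.rpow_ne_top_of_nonneg (by linarith) hC₁)) ENNReal.ofReal_ne_top
  refine (setLIntegral_mono_ae' measurableSet_ball.compl hpt).trans ?_
  rw [lintegral_const_mul' _ _ hct]
  have f1 : (∫⁻ x in B, V ‖x‖ * ‖h x‖ₑ ^ p) ^ (a / p) ≤ 1 :=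
    ENNReal.rpow_le_one ((setLIntegral_le_lintegral _ _).trans
      (lintegral_potential_le_one hp0 hh1)) (by positivity)
  have f3 : (∫⁻ x in B, V ‖x‖ * ‖u x‖ₑ ^ p) ^ (b / p) ≤ 1 :=
    ENNReal.rpow_le_one ((setLIntegral_le_lintegral _ _).trans
      (lintegral_potential_le_one hp0 hu1)) (by positivity)
  have f2 : (∫⁻ x in B, ‖h x‖ₑ ^ pstar) ^ ((1 - a) / pstar) ≤ S ^ (1 - a) :=
    (ENNReal.rpow_le_rpow (setLIntegral_le_lintegral _ _)
      (div_nonneg (by linarith) hps0.le)).trans hstar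
  have f4 : (∫⁻ x in B, ENNReal.ofReal (‖x‖ ^ (-(N + δ)))) ^ θ ≤ M ^ θ :=
    ENNReal.rpow_le_rpow (lintegral_mono_set
      (compl_subset_compl.2 (Metric.ball_subset_ball hR1))) hθ0
  calc _ ≤ Λ * C₁ ^ (q - 1 - b) * ENNReal.ofReal (R ^ (-δ)) * (1 * S ^ (1 - a) * 1 * M ^ θ) := by
        refine mul_le_mul_right (hH.trans ?_) _
        exact mul_le_mul' (mul_le_mul' (mul_le_mul' f1 f2) f3) f4
    _ = _ := by ring

end PLaplace

end

theorem mainTheorem3 (N : ℕ) (p : ℝ) (hp : 1 < p) (hpN : p < N)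
    (V : ℝ → ℝ≥0∞) (K : ℝ → ℝ) (hV : PLaplace.CondV V) (hK : PLaplace.CondK K)
    (R₂ : ℝ) (hR₂ : 0 < R₂) (hVfin : ∀ᵐ r ∂(volume.restrict (Ioi R₂)), V r < ⊤)
    (α β : ℝ) (hβ₀ : 0 ≤ β) (hβ₁ : β ≤ 1)
    (hess : essSup (fun r : ℝ => ENNReal.ofReal (K r) / (ENNReal.ofReal r ^ α * V r ^ β))
      (volume.restrict (Ioi R₂)) < ⊤)
    (q : ℝ) (hq : max 1 (max (p * β) (PLaplace.qStar N p α β)) < q) :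
    Tendsto (fun R : ℝ => PLaplace.RInfty N p V K q R) atTop (𝓝 0) := by
  rw [max_lt_iff, max_lt_iff] at hq
  obtain ⟨C, hC, δ, hδ, h⟩ := PLaplace.exists_RInfty_le hp hpN hV.1 hK.2.1 hR₂ hVfin hβ₀ hβ₁ hess
    hq.1 hq.2.1 hq.2.2
  have h1 : Tendsto (fun R : ℝ => C * ENNReal.ofReal (R ^ (-δ))) atTop (𝓝 0) := by
    have h2 := ENNReal.Tendsto.const_mul (a := C)
      (ENNReal.tendsto_ofReal (tendsto_rpow_neg_atTop hδ)) (Or.inr hC)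
    simpa using h2
  refine tendsto_of_tendsto_of_tendsto_of_le_of_le' tendsto_const_nhds h1
    (Eventually.of_forall fun _ => zero_le) ?_
  filter_upwards [eventually_ge_atTop 1, eventually_gt_atTop R₂] with R hR1 hR2 using h R hR1 hR2
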